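/- Write $\mathcal{M}_d$ for the complex $d\times d$ matrices and $\vartheta_d:\mathcal{M}_d\to\mathcal{M}_d$, $\vartheta_d(X)=X^T$, for the transposition. A linear map $P:\mathcal{M}_{d_A}\to\mathcal{M}_{d_B}$ is called \emph{positive} if it maps positive semidefinite matrices to positive semidefinite matrices; \emph{completely positive} if $\mathrm{id}_k\otimes P$ is positive for all $k\in\mathbb{N}$; \emph{completely copositive} if $\vartheta_k\otimes P$ is positive for all $k\in\mathbb{N}$; \emph{decomposable} if $P=T_1+\vartheta_{d_B}\circ T_2$ for some completely positive maps $T_1,T_2:\mathcal{M}_{d_A}\to\mathcal{M}_{d_B}$; and \emph{tensor-stable positive} if $P^{\otimes n}$ is positive for all integers $n\geq 1$. **Theorem.** Suppose that for some $d_A,d_B\in\mathbb{N}$ there exists a tensor-stable positive map $P:\mathcal{M}_{d_A}\to\mathcal{M}_{d_B}$ that is neither completely positive nor completely copositive. Then the following statement (an equivalent formulation of the PPT squared conjecture) is false: for all $d_1,d_2,d_3\in\mathbb{N}$, every map $T:\mathcal{M}_{d_1}\to\mathcal{M}_{d_2}$ that is both completely positive and completely copositive, and every positive map $P:\mathcal{M}_{d_2}\to\mathcal{M}_{d_3}$,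 the composition $P\circ T$ is decomposable. -/

import Mathlib

open scoped Kronecker ComplexOrder

/-- A linear map between complex matrix algebras is *positive* if it sends positive semidefinite
matrices to positive semidefinite matrices. -/
def IsPositiveMap {m n : Type} [Fintype m] [DecidableEq m] [Fintype n] [DecidableEq n]
    (P : Matrix m m ℂ →ₗ[ℂ] Matrix n n ℂ) : Prop :=
  ∀ X : Matrix m m ℂ, X.PosSemidef → (P X).PosSemidef

/-- The matrix transposition `X ↦ Xᵀ` in the computational basis, as a linear map. -/
def transposeMap (m : Type) [Fintype m] [DecidableEq m] :
    Matrix m m ℂ →ₗ[ℂ] Matrix m m ℂ :=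
  (Matrix.transposeLinearEquiv m m ℂ ℂ).toLinearMap

/-- The tensor product `S ⊗ T` of two linear maps between matrix algebras, where the tensor product
of the matrix algebras over `m` and `m'` is identified with the matrix algebra over `m × m'`
through the Kronecker product. -/
noncomputable def tensorMap {m n m' n' : Type} [Fintype m] [DecidableEq m] [Fintype n]
    [DecidableEq n] [Fintype m'] [DecidableEq m'] [Fintype n'] [DecidableEq n']
    (S : Matrix m m ℂ →ₗ[ℂ] Matrix n n ℂ) (T : Matrix m' m' ℂ →ₗ[ℂ] Matrix n' n' ℂ) :
    Matrix (m × m') (m × m') ℂ →ₗ[ℂ] Matrix (n × n') (n × n') ℂ where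
  toFun X := ∑ a : m × m', ∑ b : m × m',
    X a b • (S (Matrix.single a.1 b.1 1) ⊗ₖ T (Matrix.single a.2 b.2 1))
  map_add' X Y := by
    simp only [Matrix.add_apply, add_smul, Finset.sum_add_distrib]
  map_smul' c X := by
    simp only [Matrix.smul_apply, smul_eq_mul, mul_smul, Finset.smul_sum, RingHom.id_apply]

/-- The product matrix `X 0 ⊗ ⋯ ⊗ X (N - 1)`, with rows and columns indexed by multi-indices. -/
def piKronecker {N : ℕ} {m : Type} (X : Fin N → Matrix m m ℂ) :
    Matrix (Fin N → m) (Fin N → m) ℂ :=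
  Matrix.of fun f g => ∏ i, X i (f i) (g i)

/-- The tensor power `P ⊗ ⋯ ⊗ P` (`N` factors), where the `N`-fold tensor power of the matrix
algebra over `m` is identified with the matrix algebra over the multi-indices `Fin N → m`. -/
noncomputable def tensorPowerMap {m n : Type} [Fintype m] [DecidableEq m] [Fintype n]
    [DecidableEq n] (P : Matrix m m ℂ →ₗ[ℂ] Matrix n n ℂ) (N : ℕ) :
    Matrix (Fin N → m) (Fin N → m) ℂ →ₗ[ℂ] Matrix (Fin N → n) (Fin N → n) ℂ where
  toFun X := ∑ a : Fin N → m, ∑ b : Fin N → m,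
    X a b • piKronecker fun i => P (Matrix.single (a i) (b i) 1)
  map_add' X Y := by
    simp only [Matrix.add_apply, add_smul, Finset.sum_add_distrib]
  map_smul' c X := by
    simp only [Matrix.smul_apply, smul_eq_mul, mul_smul, Finset.smul_sum, RingHom.id_apply]

/-- A linear map is determined by its values on the matrix units, entry by entry. -/
theorem map_apply_eq_sum_single {m n : Type} [Fintype m] [DecidableEq m] [Fintype n]
    [DecidableEq n] (P : Matrix m m ℂ →ₗ[ℂ] Matrix n n ℂ) (X : Matrix m m ℂ) (k l : n) :
    P X k l = ∑ a, ∑ b, X a b * P (Matrix.single a b 1) k l := by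
  have h : X = ∑ a, ∑ b, X a b • Matrix.single a b (1 : ℂ) := by
    conv_lhs => rw [Matrix.matrix_eq_sum_single X]
    simp
  conv_lhs => rw [h]
  simp only [map_sum, map_smul, Matrix.sum_apply, Matrix.smul_apply, smul_eq_mul]

/-- The defining property of `S ⊗ T` on product matrices. -/
theorem tensorMap_kronecker {m n m' n' : Type} [Fintype m] [DecidableEq m] [Fintype n]
    [DecidableEq n] [Fintype m'] [DecidableEq m'] [Fintype n'] [DecidableEq n']
    (S : Matrix m m ℂ →ₗ[ℂ] Matrix n n ℂ) (T : Matrix m' m' ℂ →ₗ[ℂ] Matrix n' n' ℂ)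
    (A : Matrix m m ℂ) (B : Matrix m' m' ℂ) :
    tensorMap S T (A ⊗ₖ B) = S A ⊗ₖ T B := by
  ext ⟨k, k'⟩ ⟨l, l'⟩
  simp only [tensorMap, LinearMap.coe_mk, AddHom.coe_mk, Matrix.sum_apply, Matrix.smul_apply,
    Matrix.kroneckerMap_apply, smul_eq_mul, map_apply_eq_sum_single S A,
    map_apply_eq_sum_single T B, Fintype.sum_prod_type, Finset.sum_mul_sum]
  refine Finset.sum_congr rfl fun a _ => Finset.sum_congr rfl fun a' _ =>
    Finset.sum_congr rfl fun b _ => Finset.sum_congr rfl fun b' _ => ?_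
  ring

/-- The defining property of the tensor power on product matrices. -/
theorem tensorPowerMap_piKronecker {m n : Type} [Fintype m] [DecidableEq m] [Fintype n]
    [DecidableEq n] (P : Matrix m m ℂ →ₗ[ℂ] Matrix n n ℂ) (N : ℕ)
    (X : Fin N → Matrix m m ℂ) :
    tensorPowerMap P N (piKronecker X) = piKronecker fun i => P (X i) := by
  ext k l
  simp only [tensorPowerMap, piKronecker, LinearMap.coe_mk, AddHom.coe_mk, Matrix.sum_apply,
    Matrix.smul_apply, Matrix.of_apply, smul_eq_mul]
  simp only [fun i => map_apply_eq_sum_single P (X i), Fintype.prod_sum, Finset.prod_mul_distrib]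

/-- `P` is *completely positive* if `id_k ⊗ P` is positive for all `k`. -/
def IsCompletelyPositive {m n : Type} [Fintype m] [DecidableEq m] [Fintype n] [DecidableEq n]
    (P : Matrix m m ℂ →ₗ[ℂ] Matrix n n ℂ) : Prop :=
  ∀ k : ℕ, IsPositiveMap
    (tensorMap (LinearMap.id : Matrix (Fin k) (Fin k) ℂ →ₗ[ℂ] Matrix (Fin k) (Fin k) ℂ) P)

/-- `P` is *completely copositive* if `ϑ_k ⊗ P` is positive for all `k`, where `ϑ_k` is the
transposition of `k × k` matrices. -/
def IsCompletelyCopositive {m n : Type} [Fintype m] [DecidableEq m] [Fintype n] [DecidableEq n]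
    (P : Matrix m m ℂ →ₗ[ℂ] Matrix n n ℂ) : Prop :=
  ∀ k : ℕ, IsPositiveMap (tensorMap (transposeMap (Fin k)) P)

/-- `P` is *decomposable* if it is a completely positive map plus a completely positive map
followed by transposition. -/
def IsDecomposable {m n : Type} [Fintype m] [DecidableEq m] [Fintype n] [DecidableEq n]
    (P : Matrix m m ℂ →ₗ[ℂ] Matrix n n ℂ) : Prop :=
  ∃ T₁ T₂ : Matrix m m ℂ →ₗ[ℂ] Matrix n n ℂ,
    IsCompletelyPositive T₁ ∧ IsCompletelyPositive T₂ ∧ P = T₁ + transposeMap n ∘ₗ T₂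

/-- `P` is *tensor-stable positive* if all its tensor powers are positive. -/
def IsTensorStablePositive {m n : Type} [Fintype m] [DecidableEq m] [Fintype n] [DecidableEq n]
    (P : Matrix m m ℂ →ₗ[ℂ] Matrix n n ℂ) : Prop :=
  ∀ N : ℕ, 1 ≤ N → IsPositiveMap (tensorPowerMap P N)

/-- The equivalent formulation of the PPT squared conjecture: for every map `T` that is completely
positive and completely copositive and every positive map `P`, the composition `P ∘ T` is
decomposable. -/
def PPTSquaredConjecture : Prop :=
  ∀ (d₁ d₂ d₃ : ℕ)
    (T : Matrix (Fin d₁) (Fin d₁) ℂ →ₗ[ℂ] Matrix (Fin d₂) (Fin d₂) ℂ)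
    (P : Matrix (Fin d₂) (Fin d₂) ℂ →ₗ[ℂ] Matrix (Fin d₃) (Fin d₃) ℂ),
    IsCompletelyPositive T → IsCompletelyCopositive T → IsPositiveMap P →
      IsDecomposable (P ∘ₗ T)

set_option linter.unusedSectionVars false

/-! Write `C` for the Choi matrix of `P` and Γ for the partial transpose; "neither completely
positive nor completely copositive" implies that neither `C` nor `C`^Γ is positive semidefinite.
`exists_isPPT_pairing_not_nonneg` shows that some power `C`^{⊗N} then pairs negatively with a PPT
matrix σ, which rules out decomposability of P^{⊗N}. This alone does not contradict the conjecture,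
since no PPT map has been composed.

`exists_isPPT_choi_comp` turns σ into a PPT map `T` such that Q = P^{⊗N} ∘ T is again neither
completely positive nor completely copositive. Applying the detection lemma to Q gives a power
Q^{⊗M} that is not decomposable. But Q^{⊗M} = (P^{⊗N})^{⊗M} ∘ T^{⊗M} is a positive map after a PPT
map, by tensor stability, so the conjecture would make it decomposable. -/

/-- The Choi matrix of a linear map between matrix algebras. -/
def choi {m n : Type} [DecidableEq m] (P : Matrix m m ℂ →ₗ[ℂ] Matrix n n ℂ) :
    Matrix (m × n) (m × n) ℂ :=
  Matrix.of fun x y => P (Matrix.single x.1 y.1 1) x.2 y.2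

/-- The partial transpose with respect to the first tensor factor. -/
def partialTranspose {m n : Type} (M : Matrix (m × n) (m × n) ℂ) : Matrix (m × n) (m × n) ℂ :=
  Matrix.of fun x y => M (y.1, x.2) (x.1, y.2)

/-- A matrix is PPT if it and its partial transpose are positive semidefinite. -/
def IsPPT {m n : Type} (M : Matrix (m × n) (m × n) ℂ) : Prop :=
  M.PosSemidef ∧ (partialTranspose M).PosSemidef

/-- The bilinear pairing `tr (C σᵀ)` of two matrices. -/
def pairing {ι : Type} [Fintype ι] (C σ : Matrix ι ι ℂ) : ℂ :=
  ∑ x, ∑ y, C x y * σ x y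

/-- The product of matrices over `m × n`, as a matrix over pairs of multi-indices. -/
def prodMatrix {N : ℕ} {m n : Type} (Z : Fin N → Matrix (m × n) (m × n) ℂ) :
    Matrix ((Fin N → m) × (Fin N → n)) ((Fin N → m) × (Fin N → n)) ℂ :=
  Matrix.of fun x y => ∏ i, Z i (x.1 i, x.2 i) (y.1 i, y.2 i)

/-! ### The bilinear pairing and its witnesses. -/

section pairing

variable {ι : Type} [Fintype ι]

theorem pairing_add (C σ τ : Matrix ι ι ℂ) :
    pairing C (σ + τ) = pairing C σ + pairing C τ := by
  simp [pairing, mul_add, Finset.sum_add_distrib]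

theorem pairing_add_left (C D σ : Matrix ι ι ℂ) :
    pairing (C + D) σ = pairing C σ + pairing D σ := by
  simp [pairing, add_mul, Finset.sum_add_distrib]

theorem pairing_sub (C σ τ : Matrix ι ι ℂ) :
    pairing C (σ - τ) = pairing C σ - pairing C τ := by
  simp [pairing, mul_sub, Finset.sum_sub_distrib]

theorem pairing_smul (C σ : Matrix ι ι ℂ) (c : ℂ) :
    pairing C (c • σ) = c * pairing C σ := by
  simp [pairing, Finset.mul_sum, mul_left_comm]

theorem pairing_vecMulVec (C : Matrix ι ι ℂ) (v : ι → ℂ) :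
    pairing C (Matrix.vecMulVec (star v) v) = star v ⬝ᵥ (C.mulVec v) := by
  simp only [pairing, dotProduct, Matrix.mulVec, Matrix.vecMulVec_apply, Finset.mul_sum]
  exact Finset.sum_congr rfl fun x _ => Finset.sum_congr rfl fun y _ => by ring

/-- By the Schur product theorem: the pairing is the quadratic form of the Hadamard product at the
all-ones vector. -/
theorem pairing_nonneg {C σ : Matrix ι ι ℂ} (hC : C.PosSemidef) (hσ : σ.PosSemidef) :
    0 ≤ pairing C σ := by
  have h := (hC.hadamard hσ).dotProduct_mulVec_nonneg 1
  simpa [pairing, dotProduct, Matrix.mulVec] using h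

theorem exists_real_pairing_eq {C σ : Matrix ι ι ℂ} (hC : C.IsHermitian) (hσ : σ.IsHermitian) :
    ∃ r : ℝ, pairing C σ = r := by
  rw [← Complex.conj_eq_iff_real]
  simp only [pairing, map_sum, map_mul]
  rw [Finset.sum_comm]
  refine Finset.sum_congr rfl fun x _ => Finset.sum_congr rfl fun y _ => ?_
  rw [← hC.apply x y, ← hσ.apply x y]
  rfl

theorem exists_posSemidef_pairing_neg {C : Matrix ι ι ℂ} (hC : C.IsHermitian)
    (hn : ¬ C.PosSemidef) : ∃ p : Matrix ι ι ℂ, p.PosSemidef ∧ ∃ u : ℝ, u < 0 ∧ pairing C p = u := by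
  rw [Matrix.posSemidef_iff_dotProduct_mulVec] at hn
  push Not at hn
  obtain ⟨v, hv⟩ := hn hC
  rw [← pairing_vecMulVec] at hv
  have hp := Matrix.posSemidef_vecMulVec_star_self v
  obtain ⟨u, hu⟩ := exists_real_pairing_eq hC hp.1
  refine ⟨_, hp, u, ?_, hu⟩
  rw [hu] at hv
  simpa using hv

theorem exists_smul_one_bound [DecidableEq ι] {B : Matrix ι ι ℂ} (hB : B.IsHermitian) :
    ∃ K : ℝ, 0 < K ∧ ((K : ℂ) • 1 - B).PosSemidef ∧ ((K : ℂ) • 1 + B).PosSemidef := by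
  open scoped Matrix.Norms.L2Operator MatrixOrder in
  have hB' : IsSelfAdjoint B := hB
  have h1 := hB'.le_algebraMap_norm_self
  have h2 := hB'.neg_algebraMap_norm_le_self
  rw [Matrix.le_iff] at h1 h2
  rw [Algebra.algebraMap_eq_smul_one] at h1 h2
  -- The summand 1 keeps the constant strictly positive even when `B = 0`.
  refine ⟨‖B‖ + 1, by positivity, ?_, ?_⟩
  · have e : ((‖B‖ + 1 : ℝ) : ℂ) • (1 : Matrix ι ι ℂ) - B = (‖B‖ • 1 - B) + 1 := by
      simp [add_smul]
      abel
    rw [e]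
    exact h1.add .one
  · have e : ((‖B‖ + 1 : ℝ) : ℂ) • (1 : Matrix ι ι ℂ) + B = (B - -(‖B‖ • 1)) + 1 := by
      simp [add_smul]
      abel
    rw [e]
    exact h2.add .one

end pairing

/-! ### Order bounds under entrywise products. -/

section hadamard

variable {ι κ : Type}

open Matrix in
-- Both combinations are averages of two Hadamard products of the positive semidefinite matrices `A
-- ± B` and `A' ± B'`.
theorem posSemidef_hadamard_bounds {A B A' B' : Matrix ι ι ℂ}
    (h₁ : (A - B).PosSemidef) (h₂ : (A + B).PosSemidef)
    (h₁' : (A' - B').PosSemidef) (h₂' : (A' + B').PosSemidef) :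
    (A ⊙ A' - B ⊙ B').PosSemidef ∧ (A ⊙ A' + B ⊙ B').PosSemidef := by
  have hh : (0 : ℝ) ≤ 1 / 2 := by norm_num
  have e₁ : A ⊙ A' - B ⊙ B' =
      (1 / 2 : ℝ) • ((A + B) ⊙ (A' - B') + (A - B) ⊙ (A' + B')) := by
    ext i j
    simp
    ring
  have e₂ : A ⊙ A' + B ⊙ B' =
      (1 / 2 : ℝ) • ((A + B) ⊙ (A' + B') + (A - B) ⊙ (A' - B')) := by
    ext i j
    simp
    ring
  rw [e₁, e₂]
  exact ⟨((h₂.hadamard h₁').add (h₁.hadamard h₂')).smul hh,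
    ((h₂.hadamard h₂').add (h₁.hadamard h₁')).smul hh⟩

theorem posSemidef_prod_bounds [Fintype ι] (s : Finset κ) {A B : κ → Matrix ι ι ℂ}
    (h₁ : ∀ i, (A i - B i).PosSemidef) (h₂ : ∀ i, (A i + B i).PosSemidef) :
    (Matrix.of (fun x y => ∏ i ∈ s, A i x y) - Matrix.of fun x y => ∏ i ∈ s, B i x y).PosSemidef ∧
    (Matrix.of (fun x y => ∏ i ∈ s, A i x y) + Matrix.of fun x y => ∏ i ∈ s, B i x y).PosSemidef := by
  classical
  induction s using Finset.induction_on with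
  | empty =>
    have h : (Matrix.of fun _ _ => 1 : Matrix ι ι ℂ).PosSemidef := by
      convert Matrix.posSemidef_vecMulVec_star_self (1 : ι → ℂ) using 1
      ext
      simp [Matrix.vecMulVec_apply]
    simp only [Finset.prod_empty, sub_self]
    exact ⟨.zero, h.add h⟩
  | insert i s hi ih =>
    have h := posSemidef_hadamard_bounds (h₁ i) (h₂ i) ih.1 ih.2
    simp only [Finset.prod_insert hi]
    exact h

end hadamard

/-! ### Tensor powers and detection by PPT matrices. -/

section prodMatrix

variable {m n : Type} {N : ℕ}

theorem Matrix.IsHermitian.partialTranspose {M : Matrix (m × n) (m × n) ℂ} (h : M.IsHermitian) :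
    (partialTranspose M).IsHermitian :=
  Matrix.IsHermitian.ext fun x y => h.apply (y.1, x.2) (x.1, y.2)

theorem partialTranspose_one [DecidableEq m] [DecidableEq n] :
    partialTranspose (1 : Matrix (m × n) (m × n) ℂ) = 1 := by
  ext ⟨a, k⟩ ⟨b, l⟩
  simp [partialTranspose, Matrix.one_apply, eq_comm]

variable [Fintype m] [Fintype n]

/-- A tensor product is the entrywise product of its factors pulled back along the coordinate
projections, so the Hadamard bounds apply. -/
theorem posSemidef_prodMatrix_bounds {A B : Fin N → Matrix (m × n) (m × n) ℂ}
    (h₁ : ∀ i, (A i - B i).PosSemidef) (h₂ : ∀ i, (A i + B i).PosSemidef) :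
    (prodMatrix A + prodMatrix B).PosSemidef :=
  (posSemidef_prod_bounds Finset.univ
    (fun i => (h₁ i).submatrix fun x : (Fin N → m) × (Fin N → n) => (x.1 i, x.2 i))
    (fun i => (h₂ i).submatrix fun x : (Fin N → m) × (Fin N → n) => (x.1 i, x.2 i))).2

theorem posSemidef_prodMatrix {A : Fin N → Matrix (m × n) (m × n) ℂ}
    (h : ∀ i, (A i).PosSemidef) : (prodMatrix A).PosSemidef := by
  have h' := posSemidef_prodMatrix_bounds (B := A) (A := A)
    (fun i => by rw [sub_self]; exact .zero) (fun i => (h i).add (h i))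
  convert h'.smul (show (0 : ℝ) ≤ 1 / 2 by norm_num) using 1
  ext
  simp
  ring

theorem IsPPT.prodMatrix {A : Fin N → Matrix (m × n) (m × n) ℂ} (h : ∀ i, IsPPT (A i)) :
    IsPPT (prodMatrix A) :=
  ⟨posSemidef_prodMatrix fun i => (h i).1, posSemidef_prodMatrix fun i => (h i).2⟩

theorem pairing_partialTranspose (C σ : Matrix (m × n) (m × n) ℂ) :
    pairing (partialTranspose C) σ = pairing C (partialTranspose σ) := by
  simp only [pairing, Fintype.sum_prod_type, partialTranspose, Matrix.of_apply]
  calc _ = ∑ a, ∑ b, ∑ k, ∑ l, C (b, k) (a, l) * σ (a, k) (b, l) :=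
        Finset.sum_congr rfl fun a _ => Finset.sum_comm
    _ = ∑ b, ∑ a, ∑ k, ∑ l, C (b, k) (a, l) * σ (a, k) (b, l) := Finset.sum_comm
    _ = _ := Finset.sum_congr rfl fun a _ => Finset.sum_comm

theorem pairing_prodMatrix (C Z : Fin N → Matrix (m × n) (m × n) ℂ) :
    pairing (prodMatrix C) (prodMatrix Z) = ∏ i, pairing (C i) (Z i) := by
  classical
  simp only [pairing, Fintype.prod_sum]
  refine (Fintype.sum_equiv (Equiv.arrowProdEquivProdArrow _ _ _) _ _ fun x => ?_).symm
  refine Fintype.sum_equiv (Equiv.arrowProdEquivProdArrow _ _ _) _ _ fun y => ?_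
  simp [prodMatrix, Finset.prod_mul_distrib, Equiv.arrowProdEquivProdArrow]

/-- If neither the Hermitian matrix `C` nor its partial transpose is positive semidefinite, then
some tensor power of `C` is detected by a PPT matrix. -/
theorem exists_isPPT_pairing_not_nonneg {C : Matrix (m × n) (m × n) ℂ} (hC : C.IsHermitian)
    (h₁ : ¬ C.PosSemidef) (h₂ : ¬ (partialTranspose C).PosSemidef) :
    ∃ N : ℕ, 1 ≤ N ∧ ∃ σ : Matrix ((Fin N → m) × (Fin N → n)) ((Fin N → m) × (Fin N → n)) ℂ,
      IsPPT σ ∧ ¬ 0 ≤ pairing (prodMatrix fun _ : Fin N => C) σ := by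
  classical
  obtain ⟨p, hp, u, hu, hpu⟩ := exists_posSemidef_pairing_neg hC h₁
  obtain ⟨Z, hZ, w, hw, hZw⟩ := exists_posSemidef_pairing_neg hC.partialTranspose h₂
  rw [pairing_partialTranspose] at hZw
  obtain ⟨L, hL, hL₁, hL₂⟩ := exists_smul_one_bound hp.1.partialTranspose
  obtain ⟨K, hK, hK₁, hK₂⟩ := exists_smul_one_bound hZ.1.partialTranspose
  obtain ⟨c, hc⟩ := exists_real_pairing_eq hC (Matrix.isHermitian_one (α := ℂ) (n := m × n))
  have hone : ∀ r : ℝ, partialTranspose ((r : ℂ) • (1 : Matrix (m × n) (m × n) ℂ)) =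
      (r : ℂ) • 1 := fun r => congrArg ((r : ℂ) • ·) partialTranspose_one
  have hone' : ∀ {r : ℝ}, 0 ≤ r → ((r : ℂ) • (1 : Matrix (m × n) (m × n) ℂ)).PosSemidef :=
    fun hr => Matrix.PosSemidef.one.smul (by exact_mod_cast hr)
  -- Here `c` is the trace of `C`. If `c ≤ 0`, `M = 0` suffices; otherwise `w < 0` gives |Kc + w| <
  -- Kc − w, so the negative term dominates for large `M`.
  have key : ∃ M : ℕ, u * (K * c - w) ^ M + L * c * (K * c + w) ^ M < 0 := by
    rcases le_or_gt c 0 with hc0 | hc0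
    · refine ⟨0, ?_⟩
      have := mul_nonpos_of_nonneg_of_nonpos hL.le hc0
      simp only [pow_zero]
      linarith
    · have hKc := mul_pos hK hc0
      have hpos : 0 < K * c - w := by linarith
      have hr : |(K * c + w) / (K * c - w)| < 1 := by
        rw [abs_div, abs_of_pos hpos, div_lt_one hpos, abs_lt]
        constructor <;> linarith
      have ht := (tendsto_pow_atTop_nhds_zero_of_abs_lt_one hr).const_mul (L * c)
      rw [mul_zero] at ht
      obtain ⟨M, hM⟩ := (ht.eventually (gt_mem_nhds (neg_pos.2 hu))).exists
      refine ⟨M, ?_⟩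
      rw [div_pow, ← mul_div_assoc, div_lt_iff₀ (pow_pos hpos M)] at hM
      linarith
  obtain ⟨M, hM⟩ := key
  -- The detecting matrix is σ = L·1 ⊗ (K·1 + Z^Γ)^{⊗M} + p ⊗ (K·1 − Z^Γ)^{⊗M}, whose pairing with
  -- the power of `C` is the quantity in `key`.
  let X : Fin (M + 1) → Matrix (m × n) (m × n) ℂ :=
    Fin.cons p fun _ => (K : ℂ) • 1 - partialTranspose Z
  let Y : Fin (M + 1) → Matrix (m × n) (m × n) ℂ :=
    Fin.cons ((L : ℂ) • 1) fun _ => (K : ℂ) • 1 + partialTranspose Z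
  have hX : ∀ i, (X i).PosSemidef := Fin.cases hp fun _ => hK₁
  have hY : ∀ i, (Y i).PosSemidef := Fin.cases (hone' hL.le) fun _ => hK₂
  refine ⟨M + 1, by omega, prodMatrix Y + prodMatrix X,
    ⟨(posSemidef_prodMatrix hY).add (posSemidef_prodMatrix hX), ?_⟩, ?_⟩
  · have hsub : partialTranspose ((K : ℂ) • 1 - partialTranspose Z) = (K : ℂ) • 1 - Z :=
      congrArg (· - Z) (hone K)
    have hadd : partialTranspose ((K : ℂ) • 1 + partialTranspose Z) = (K : ℂ) • 1 + Z :=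
      congrArg (· + Z) (hone K)
    -- Partial transposition acts factorwise. The first factors satisfy L·1 ± p^Γ ≥ 0; in the
    -- others, the difference and sum of K·1 + Z and K·1 − Z are 2Z and 2K·1.
    refine posSemidef_prodMatrix_bounds (A := fun i => partialTranspose (Y i))
      (B := fun i => partialTranspose (X i)) (Fin.cases ?_ fun _ => ?_) (Fin.cases ?_ fun _ => ?_)
    · simp only [X, Y, Fin.cons_zero, hone]
      exact hL₁
    · simp only [X, Y, Fin.cons_succ, hsub, hadd]
      rw [show (K : ℂ) • 1 + Z - ((K : ℂ) • 1 - Z) = Z + Z by abel]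
      exact hZ.add hZ
    · simp only [X, Y, Fin.cons_zero, hone]
      exact hL₂
    · simp only [X, Y, Fin.cons_succ, hsub, hadd, add_add_sub_cancel]
      exact (hone' hK.le).add (hone' hK.le)
  · rw [pairing_add, pairing_prodMatrix, pairing_prodMatrix, Fin.prod_univ_succ,
      Fin.prod_univ_succ]
    simp only [X, Y, Fin.cons_zero, Fin.cons_succ, Finset.prod_const, Finset.card_univ,
      Fintype.card_fin, pairing_smul, pairing_add, pairing_sub, hc, hpu, hZw]
    refine fun h => hM.not_ge (Complex.real_le_real.1 ?_)
    push_cast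
    rw [add_comm]
    exact h

end prodMatrix

theorem Matrix.PosSemidef.of_eq {ι : Type} {A B : Matrix ι ι ℂ} (hB : B.PosSemidef) (h : A = B) :
    A.PosSemidef :=
  h ▸ hB

/-! ### Contractions and direct sums of positive semidefinite matrices. -/

section contraction

variable {ι m : Type} [Fintype ι] [Fintype m]

/-- Test `M` on vectors that are constant in the second index. Combined with the Schur product, this
proves the Choi criteria. -/
theorem posSemidef_contraction {M : Matrix (ι × m) (ι × m) ℂ} (hM : M.PosSemidef) :
    (Matrix.of fun i j => ∑ a, ∑ b, M (i, a) (j, b)).PosSemidef := by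
  refine .of_dotProduct_mulVec_nonneg (Matrix.IsHermitian.ext fun i j => ?_) fun v => ?_
  · simp only [Matrix.of_apply, star_sum, hM.1.apply]
    exact Finset.sum_comm
  · have h := hM.dotProduct_mulVec_nonneg fun x => v x.1
    convert h using 1
    simp only [dotProduct, Matrix.mulVec, Fintype.sum_prod_type, Matrix.of_apply, Pi.star_apply,
      Finset.mul_sum, Finset.sum_mul]
    refine Finset.sum_congr rfl fun i _ => ?_
    rw [Finset.sum_comm]

theorem sum_sum_apply_nonneg {κ : Type} {M : Matrix κ κ ℂ} (hM : M.PosSemidef) (f : ι → κ) :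
    0 ≤ ∑ x, ∑ y, M (f x) (f y) := by
  simpa [dotProduct, Matrix.mulVec] using (hM.submatrix f).dotProduct_mulVec_nonneg 1

theorem posSemidef_directSum {κ : Type} [Fintype κ] [DecidableEq κ] {D : κ → Matrix ι ι ℂ}
    (h : ∀ s, (D s).PosSemidef) :
    (Matrix.of fun x y : κ × ι => if x.1 = y.1 then D x.1 x.2 y.2 else 0).PosSemidef := by
  have key := Matrix.posSemidef_sum Finset.univ fun r _ =>
    (Matrix.posSemidef_vecMulVec_star_self fun x : κ × ι => if x.1 = r then (1 : ℂ) else 0).hadamard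
      ((h r).submatrix Prod.snd)
  refine key.of_eq ?_
  ext x y
  simp only [Matrix.of_apply, Matrix.sum_apply, Matrix.hadamard_apply, Matrix.vecMulVec_apply,
    Matrix.submatrix_apply, Pi.star_apply, apply_ite star, star_one, star_zero, ite_mul, one_mul,
    zero_mul]
  rw [Finset.sum_ite_eq, if_pos (Finset.mem_univ _)]
  exact if_congr eq_comm rfl rfl

theorem pairing_transpose (C σ : Matrix ι ι ℂ) :
    pairing C.transpose σ = pairing C σ.transpose :=
  Finset.sum_comm

theorem pairing_submatrix_equiv {κ : Type} [Fintype κ] (e : ι ≃ κ) (C σ : Matrix κ κ ℂ) :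
    pairing (C.submatrix e e) (σ.submatrix e e) = pairing C σ :=
  Fintype.sum_equiv e _ _ fun _ => Fintype.sum_equiv e _ _ fun _ => rfl

end contraction

/-! ### Choi matrices, positivity criteria and tensor powers. -/

section choi

variable {m n o : Type} [Fintype m] [DecidableEq m] [Fintype n] [DecidableEq n]
  [Fintype o] [DecidableEq o]

theorem apply_eq_sum_choi (P : Matrix m m ℂ →ₗ[ℂ] Matrix n n ℂ) (X : Matrix m m ℂ) (k l : n) :
    P X k l = ∑ a, ∑ b, X a b * choi P (a, k) (b, l) :=
  map_apply_eq_sum_single P X k l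

theorem choi_comp (P : Matrix n n ℂ →ₗ[ℂ] Matrix o o ℂ) (T : Matrix m m ℂ →ₗ[ℂ] Matrix n n ℂ)
    (x y : m × o) :
    choi (P ∘ₗ T) x y = ∑ a, ∑ b, choi T (x.1, a) (y.1, b) * choi P (a, x.2) (b, y.2) :=
  map_apply_eq_sum_single P _ _ _

/-- The linear map with a given Choi matrix. -/
noncomputable def mapOfChoi (C : Matrix (m × n) (m × n) ℂ) :
    Matrix m m ℂ →ₗ[ℂ] Matrix n n ℂ where
  toFun X := Matrix.of fun k l => ∑ a, ∑ b, X a b * C (a, k) (b, l)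
  map_add' X Y := by
    ext
    simp [add_mul, Finset.sum_add_distrib]
  map_smul' c X := by
    ext
    simp [mul_assoc, Finset.mul_sum]

theorem choi_mapOfChoi (C : Matrix (m × n) (m × n) ℂ) : choi (mapOfChoi C) = C := by
  ext ⟨a, k⟩ ⟨b, l⟩
  simp [choi, mapOfChoi, Matrix.single_apply, ite_and]

theorem tensorMap_apply {k : Type} [Fintype k] [DecidableEq k] (S : Matrix k k ℂ →ₗ[ℂ] Matrix k k ℂ)
    (P : Matrix m m ℂ →ₗ[ℂ] Matrix n n ℂ) (X : Matrix (k × m) (k × m) ℂ) (x y : k × n) :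
    tensorMap S P X x y = ∑ a, ∑ b, ∑ i, ∑ j,
      X (i, a) (j, b) * (S (Matrix.single i j 1) x.1 y.1 * choi P (a, x.2) (b, y.2)) := by
  simp only [tensorMap, LinearMap.coe_mk, AddHom.coe_mk, Matrix.sum_apply, Matrix.smul_apply,
    Matrix.kroneckerMap_apply, smul_eq_mul, Fintype.sum_prod_type, choi, Matrix.of_apply]
  rw [Finset.sum_comm]
  refine Finset.sum_congr rfl fun a _ => ?_
  calc _ = ∑ i, ∑ b, ∑ j, _ := Finset.sum_congr rfl fun i _ => Finset.sum_comm
    _ = _ := Finset.sum_comm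

theorem tensorMap_id_apply {k : Type} [Fintype k] [DecidableEq k]
    (P : Matrix m m ℂ →ₗ[ℂ] Matrix n n ℂ) (X : Matrix (k × m) (k × m) ℂ) (x y : k × n) :
    tensorMap LinearMap.id P X x y =
      ∑ a, ∑ b, X (x.1, a) (y.1, b) * choi P (a, x.2) (b, y.2) := by
  rw [tensorMap_apply]
  simp [Matrix.single_apply, ite_and]

theorem tensorMap_transposeMap_apply {k : Type} [Fintype k] [DecidableEq k]
    (P : Matrix m m ℂ →ₗ[ℂ] Matrix n n ℂ) (X : Matrix (k × m) (k × m) ℂ) (x y : k × n) :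
    tensorMap (transposeMap k) P X x y =
      ∑ a, ∑ b, X (y.1, a) (x.1, b) * choi P (a, x.2) (b, y.2) := by
  rw [tensorMap_apply]
  simp [transposeMap, Matrix.single_apply, ite_and]

theorem isCompletelyPositive_of_choi {P : Matrix m m ℂ →ₗ[ℂ] Matrix n n ℂ}
    (h : (choi P).PosSemidef) : IsCompletelyPositive P := by
  intro k X hX
  have key := posSemidef_contraction
    ((hX.submatrix fun x : (Fin k × n) × m => (x.1.1, x.2)).hadamard
      (h.submatrix fun x : (Fin k × n) × m => (x.2, x.1.2)))
  convert key using 1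
  ext x y
  exact tensorMap_id_apply P X x y

theorem isCompletelyCopositive_of_choi {P : Matrix m m ℂ →ₗ[ℂ] Matrix n n ℂ}
    (h : (partialTranspose (choi P)).PosSemidef) : IsCompletelyCopositive P := by
  intro k X hX
  have key := posSemidef_contraction
    ((hX.transpose.submatrix fun x : (Fin k × n) × m => (x.1.1, x.2)).hadamard
      (h.submatrix fun x : (Fin k × n) × m => (x.2, x.1.2)))
  convert key using 1
  ext x y
  rw [tensorMap_transposeMap_apply, Finset.sum_comm]
  rfl

/-- The Choi matrix is the image under id ⊗ P of the unnormalised maximally entangled projector. -/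
theorem IsCompletelyPositive.posSemidef_choi {d : ℕ} {P : Matrix (Fin d) (Fin d) ℂ →ₗ[ℂ] Matrix n n ℂ}
    (h : IsCompletelyPositive P) : (choi P).PosSemidef := by
  have key := h d _ (Matrix.posSemidef_vecMulVec_star_self
    fun x : Fin d × Fin d => if x.1 = x.2 then (1 : ℂ) else 0)
  convert key using 1
  ext x y
  rw [tensorMap_id_apply]
  simp [Matrix.vecMulVec_apply, apply_ite]

/-- Polarisation: the images of the rank-one matrices of e_a, e_a + e_b and e_a + i e_b are
Hermitian, which determines the adjoint of the image of each matrix unit. -/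
theorem IsPositiveMap.isHermitian_choi {P : Matrix m m ℂ →ₗ[ℂ] Matrix n n ℂ}
    (h : IsPositiveMap P) : (choi P).IsHermitian := by
  have hv := fun v : m → ℂ => (h _ (Matrix.posSemidef_vecMulVec_star_self v)).1
  refine Matrix.IsHermitian.ext fun x y => ?_
  obtain ⟨a, k⟩ := x
  obtain ⟨b, l⟩ := y
  have hs : ∀ (a b : m) (c d : ℂ), Matrix.vecMulVec (star (Pi.single a c)) (Pi.single b d) =
      (star c * d) • Matrix.single a b (1 : ℂ) := by
    intro a b c d
    ext i j
    rcases eq_or_ne i a with rfl | hi <;> rcases eq_or_ne j b with rfl | hj <;>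
      simp [Matrix.vecMulVec_apply, *, Ne.symm]
  have e : ∀ c : ℂ, P (Matrix.vecMulVec (star (Pi.single a 1 + Pi.single b c))
      (Pi.single a 1 + Pi.single b c)) = P (Matrix.single a a 1) +
      c • P (Matrix.single a b 1) + star c • P (Matrix.single b a 1) +
      (star c * c) • P (Matrix.single b b 1) := by
    intro c
    rw [star_add, Matrix.add_vecMulVec, Matrix.vecMulVec_add, Matrix.vecMulVec_add]
    simp only [hs, map_add, map_smul]
    simp [add_assoc]
  have h0 : ∀ a : m, (P (Matrix.single a a 1)).IsHermitian := fun a => by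
    have h := hv (Pi.single a 1)
    rw [hs] at h
    simpa using h
  have h1 := hv (Pi.single a 1 + Pi.single b 1)
  have h2 := hv (Pi.single a 1 + Pi.single b Complex.I)
  rw [e] at h1 h2
  have haa := (h0 a).apply k l
  have hbb := (h0 b).apply k l
  have h1' := h1.apply k l
  have h2' := h2.apply k l
  simp only [Matrix.add_apply, Matrix.smul_apply, smul_eq_mul, star_add, star_mul', haa, hbb,
    star_one, one_mul, Complex.star_def, Complex.conj_I, map_neg] at h1' h2'
  simp only [choi, Matrix.of_apply, Complex.star_def]
  linear_combination (1 / 2 : ℂ) * h1' - Complex.I / 2 * h2' +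
    (1 / 2 : ℂ) * (-(starRingEnd ℂ) (P (Matrix.single a b 1) l k) +
      (starRingEnd ℂ) (P (Matrix.single b a 1) l k) - P (Matrix.single a b 1) k l +
      P (Matrix.single b a 1) k l) * Complex.I_sq

theorem tensorPowerMap_single (P : Matrix m m ℂ →ₗ[ℂ] Matrix n n ℂ) (N : ℕ) (a b : Fin N → m) :
    tensorPowerMap P N (Matrix.single a b 1) =
      piKronecker fun i => P (Matrix.single (a i) (b i) 1) := by
  rw [← tensorPowerMap_piKronecker]
  congr 1
  ext f g
  simp only [piKronecker, Matrix.of_apply, Matrix.single_apply, Finset.prod_ite_zero,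
    Finset.prod_const_one, Finset.mem_univ, forall_true_left, funext_iff, forall_and]

theorem choi_tensorPowerMap (P : Matrix m m ℂ →ₗ[ℂ] Matrix n n ℂ) (N : ℕ) :
    choi (tensorPowerMap P N) = prodMatrix fun _ => choi P := by
  ext x y
  simp only [choi, Matrix.of_apply, tensorPowerMap_single]
  rfl

theorem tensorPowerMap_comp (P : Matrix n n ℂ →ₗ[ℂ] Matrix o o ℂ)
    (T : Matrix m m ℂ →ₗ[ℂ] Matrix n n ℂ) (N : ℕ) :
    tensorPowerMap (P ∘ₗ T) N = tensorPowerMap P N ∘ₗ tensorPowerMap T N := by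
  refine Matrix.ext_linearMap _ fun a b => LinearMap.ext_ring ?_
  simp [tensorPowerMap_single, tensorPowerMap_piKronecker]

theorem IsPositiveMap.tensorPowerMap_tensorPowerMap {P : Matrix m m ℂ →ₗ[ℂ] Matrix n n ℂ}
    {M N : ℕ} (h : IsPositiveMap (tensorPowerMap P (M * N))) :
    IsPositiveMap (tensorPowerMap (tensorPowerMap P N) M) := by
  let e (α : Type) : (Fin M → Fin N → α) ≃ (Fin (M * N) → α) :=
    (Equiv.curry _ _ _).symm.trans (Equiv.arrowCongr finProdFinEquiv (Equiv.refl α))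
  intro X hX
  have key := (h _ (hX.submatrix (e m).symm)).submatrix (e n)
  convert key using 1
  ext k l
  rw [apply_eq_sum_choi, Matrix.submatrix_apply, apply_eq_sum_choi]
  refine Fintype.sum_equiv (e m) _ _ fun a => Fintype.sum_equiv (e m) _ _ fun b => ?_
  simp only [choi_tensorPowerMap, Matrix.submatrix_apply, Equiv.symm_apply_apply, prodMatrix,
    Matrix.of_apply]
  congr 1
  rw [← finProdFinEquiv.prod_comp, Fintype.prod_prod_type]
  simp [e]

end choi

/-! ### Consequences of decomposability and transfer to arbitrary index types. -/

section decomposable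

theorem IsDecomposable.pairing_nonneg {d : ℕ} {n : Type} [Fintype n] [DecidableEq n]
    {P : Matrix (Fin d) (Fin d) ℂ →ₗ[ℂ] Matrix n n ℂ} (h : IsDecomposable P)
    {τ : Matrix (Fin d × n) (Fin d × n) ℂ} (hτ : IsPPT τ) : 0 ≤ pairing (choi P) τ := by
  obtain ⟨T₁, T₂, h₁, h₂, rfl⟩ := h
  -- Output transposition is the partial transpose in the second factor, that is, Γ followed by the
  -- full transpose.
  have e : choi (T₁ + transposeMap n ∘ₗ T₂) =
      choi T₁ + (partialTranspose (choi T₂)).transpose := rfl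
  rw [e, pairing_add_left, pairing_transpose, pairing_partialTranspose]
  exact add_nonneg (_root_.pairing_nonneg h₁.posSemidef_choi hτ.1)
    (_root_.pairing_nonneg h₂.posSemidef_choi hτ.2.transpose)

variable {α β γ α' β' γ' : Type} [Fintype α] [DecidableEq α] [Fintype β] [DecidableEq β]
  [Fintype γ] [DecidableEq γ] [Fintype α'] [DecidableEq α'] [Fintype β'] [DecidableEq β']
  [Fintype γ'] [DecidableEq γ']

/-- Relabelling of the indices of a linear map between matrix algebras. -/
noncomputable def reindexMap (e : α ≃ α') (f : β ≃ β') (P : Matrix α α ℂ →ₗ[ℂ] Matrix β β ℂ) :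
    Matrix α' α' ℂ →ₗ[ℂ] Matrix β' β' ℂ :=
  (Matrix.reindexLinearEquiv ℂ ℂ f f).toLinearMap ∘ₗ P ∘ₗ
    (Matrix.reindexLinearEquiv ℂ ℂ e.symm e.symm).toLinearMap

theorem choi_reindexMap (e : α ≃ α') (f : β ≃ β') (P : Matrix α α ℂ →ₗ[ℂ] Matrix β β ℂ) :
    choi (reindexMap e f P) =
      (choi P).submatrix (e.prodCongr f).symm (e.prodCongr f).symm := by
  ext x y
  simp [choi, reindexMap]

theorem reindexMap_comp (e : α ≃ α') (f : β ≃ β') (g : γ ≃ γ')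
    (P : Matrix β β ℂ →ₗ[ℂ] Matrix γ γ ℂ) (T : Matrix α α ℂ →ₗ[ℂ] Matrix β β ℂ) :
    reindexMap f g P ∘ₗ reindexMap e f T = reindexMap e g (P ∘ₗ T) := by
  ext : 1
  simp [reindexMap]

theorem IsPositiveMap.reindexMap {P : Matrix α α ℂ →ₗ[ℂ] Matrix β β ℂ} (h : IsPositiveMap P)
    (e : α ≃ α') (f : β ≃ β') : IsPositiveMap (reindexMap e f P) :=
  fun _ hX => (h _ (hX.submatrix e)).submatrix f.symm

theorem IsPPT.submatrix_prodCongr {M : Matrix (α × β) (α × β) ℂ} (h : IsPPT M) (e : α' ≃ α)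
    (f : β' ≃ β) : IsPPT (M.submatrix (e.prodCongr f) (e.prodCongr f)) :=
  ⟨h.1.submatrix _, h.2.submatrix (e.prodCongr f)⟩

/-- Under the PPT squared conjecture, `P ∘ T` has nonnegative pairing with every PPT matrix. -/
theorem PPTSquaredConjecture.pairing_nonneg (h : PPTSquaredConjecture)
    {T : Matrix α α ℂ →ₗ[ℂ] Matrix β β ℂ} {P : Matrix β β ℂ →ₗ[ℂ] Matrix γ γ ℂ}
    (hT : IsPPT (choi T)) (hP : IsPositiveMap P) {τ : Matrix (α × γ) (α × γ) ℂ} (hτ : IsPPT τ) :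
    0 ≤ pairing (choi (P ∘ₗ T)) τ := by
  let e := Fintype.equivFin α
  let f := Fintype.equivFin β
  let g := Fintype.equivFin γ
  have hT' : IsPPT (choi (reindexMap e f T)) := by
    rw [choi_reindexMap]
    exact hT.submatrix_prodCongr e.symm f.symm
  have hd := h _ _ _ _ _ (isCompletelyPositive_of_choi hT'.1)
    (isCompletelyCopositive_of_choi hT'.2) (hP.reindexMap f g)
  have key := hd.pairing_nonneg (hτ.submatrix_prodCongr e.symm g.symm)
  rw [reindexMap_comp, choi_reindexMap] at key
  rwa [← pairing_submatrix_equiv (e.prodCongr g).symm]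

end decomposable

/-! ### From a detecting PPT matrix to a PPT map. -/

section detection

variable {m n : Type} [Fintype m] [DecidableEq m] [Fintype n] [DecidableEq n]

/-- If a PPT matrix detects `P`, then some PPT map `T` makes `P ∘ T` neither completely positive nor
completely copositive. -/
theorem exists_isPPT_choi_comp {P : Matrix m m ℂ →ₗ[ℂ] Matrix n n ℂ}
    {σ : Matrix (m × n) (m × n) ℂ} (hσ : IsPPT σ) (h : ¬ 0 ≤ pairing (choi P) σ) :
    ∃ T : Matrix (Bool × n) (Bool × n) ℂ →ₗ[ℂ] Matrix m m ℂ, IsPPT (choi T) ∧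
      ¬ (choi (P ∘ₗ T)).PosSemidef ∧ ¬ (partialTranspose (choi (P ∘ₗ T))).PosSemidef := by
  -- One block for each failure: the flipped σ defeats complete positivity, its partial transpose
  -- complete copositivity. Γ exchanges the blocks, so both are PPT.
  let D : Bool → Matrix (n × m) (n × m) ℂ := fun s =>
    bif s then σ.submatrix Prod.swap Prod.swap
    else partialTranspose (σ.submatrix Prod.swap Prod.swap)
  have hD : ∀ s, IsPPT (D s) := by
    have h₁ : (D true).PosSemidef := hσ.1.submatrix Prod.swap
    have h₂ : (D false).PosSemidef := hσ.2.transpose.submatrix Prod.swap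
    rintro (_ | _)
    · exact ⟨h₂, h₁⟩
    · exact ⟨h₁, h₂⟩
  let C : Matrix ((Bool × n) × m) ((Bool × n) × m) ℂ :=
    Matrix.of fun x y => if x.1.1 = y.1.1 then D x.1.1 (x.1.2, x.2) (y.1.2, y.2) else 0
  have hC : IsPPT C := by
    constructor
    · exact (posSemidef_directSum fun s => (hD s).1).submatrix
        fun x : (Bool × n) × m => (x.1.1, (x.1.2, x.2))
    · refine ((posSemidef_directSum fun s => (hD s).2).submatrix
        fun x : (Bool × n) × m => (x.1.1, (x.1.2, x.2))).of_eq ?_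
      ext ⟨⟨s, k⟩, a⟩ ⟨⟨t, l⟩, b⟩
      simp only [C, partialTranspose, Matrix.of_apply, Matrix.submatrix_apply]
      by_cases hst : s = t
      · subst hst
        simp
      · rw [if_neg hst, if_neg (Ne.symm hst)]
  have hpair : pairing (choi P) σ =
      ∑ k, ∑ l, ∑ a, ∑ b, σ (a, k) (b, l) * choi P (a, k) (b, l) := by
    simp only [pairing, Fintype.sum_prod_type]
    rw [Finset.sum_comm]
    refine Finset.sum_congr rfl fun k _ => ?_
    simp only [mul_comm]
    calc _ = ∑ a, ∑ l, ∑ b, _ := Finset.sum_congr rfl fun a _ => Finset.sum_comm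
      _ = _ := Finset.sum_comm
  refine ⟨mapOfChoi C, by rwa [choi_mapOfChoi], fun hn => h ?_, fun hn => h ?_⟩
  -- On the maximally entangled vector of the `true` block, the quadratic form of the Choi matrix
  -- equals the pairing of `choi P` with σ.
  · have key := sum_sum_apply_nonneg hn fun k : n => ((true, k), k)
    simp only [choi_comp, choi_mapOfChoi] at key
    rw [hpair]
    exact key
  · have key := sum_sum_apply_nonneg hn fun k : n => ((false, k), k)
    simp only [partialTranspose, Matrix.of_apply, choi_comp, choi_mapOfChoi] at key
    rw [hpair]
    exact key

end detection

/-! ### Conclusion: detection applied twice. -/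

theorem mainTheorem11
    (h : ∃ (dA dB : ℕ) (P : Matrix (Fin dA) (Fin dA) ℂ →ₗ[ℂ] Matrix (Fin dB) (Fin dB) ℂ),
      IsTensorStablePositive P ∧ ¬ IsCompletelyPositive P ∧ ¬ IsCompletelyCopositive P) :
    ¬ PPTSquaredConjecture := by
  intro hPPT
  obtain ⟨dA, dB, P, hP, h₁, h₂⟩ := h
  have hP1 : (choi P).IsHermitian := by
    have h := (hP 1 le_rfl).isHermitian_choi
    rw [choi_tensorPowerMap] at h
    refine Matrix.IsHermitian.ext fun x y => ?_
    simpa [prodMatrix] using h.apply (fun _ => x.1, fun _ => x.2) (fun _ => y.1, fun _ => y.2)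
  obtain ⟨N, hN, σ, hσ, hPσ⟩ := exists_isPPT_pairing_not_nonneg hP1
    (fun hc => h₁ (isCompletelyPositive_of_choi hc))
    (fun hc => h₂ (isCompletelyCopositive_of_choi hc))
  rw [← choi_tensorPowerMap] at hPσ
  obtain ⟨T, hT, hQ₁, hQ₂⟩ := exists_isPPT_choi_comp hσ hPσ
  have hPN := (hP N hN).isHermitian_choi
  have hQ : (choi (tensorPowerMap P N ∘ₗ T)).IsHermitian := by
    refine Matrix.IsHermitian.ext fun x y => ?_
    rw [choi_comp, choi_comp]
    simp only [star_sum, star_mul', hPN.apply, hT.1.1.apply]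
    exact Finset.sum_comm
  obtain ⟨M, hM, τ, hτ, hQτ⟩ := exists_isPPT_pairing_not_nonneg hQ hQ₁ hQ₂
  rw [← choi_tensorPowerMap, tensorPowerMap_comp] at hQτ
  refine hQτ (hPPT.pairing_nonneg ?_ ?_ hτ)
  · rw [choi_tensorPowerMap]
    exact IsPPT.prodMatrix fun _ => hT
  · exact (hP (M * N) (Nat.mul_pos hM hN)).tensorPowerMap_tensorPowerMap
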